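/- Let $\alpha\in(0,1)$, $\delta\in(0,1/2)$, $D\in(0,1/4)$, and set $$\Delta=\min\Big\{\tfrac14,\ \tfrac{1}{4\sqrt2}\sqrt{\tfrac{1-\alpha}{\delta}}\Big\},\qquad 0<\varepsilon\le \tfrac1{36}\min\Big\{(1-\alpha)^2,\ \tfrac{(1-\alpha)^3}{2\delta}\Big\},\quad \varepsilon\le\delta .$$ Consider the infinite-armed Bernoulli bandit with a countably infinite set of arms whose mean rewards $(\theta_a)_a$ are independent random variables with $$\mathbb P(\theta_a=\tfrac12-\Delta)=1-\delta,\qquad \mathbb P(\theta_a=\tfrac12)=\delta-\varepsilon,\qquad \mathbb P(\theta_a=\tfrac12+D)=\varepsilon .$$ An adaptive policy $\psi=(\psi_t)_{t\ge 0}$ is a sequence of measurable functions selecting the arms $A_t=\psi_t(\mathcal H_{t-1},\xi)$ from the history $\mathcal H_{t-1}=(A_0,R_0,\dots,A_{t-1},R_{t-1})$ and a random seed $\xi$ that is independent of $\theta$. The rewards are $R_t\in\{0,1\}$ with $\mathbb P(R_t=1\mid\theta,\xi,A_t,\mathcal H_{t-1})=\theta_{A_t}$. Let $R^*=\sup_a\theta_a$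 and $$\mathrm{SRegret}(\alpha,\psi,D)=\mathbb E\Big[\sum_{t=0}^\infty\alpha^t\,(R^*-D-R_t)\Big].$$ Then every adaptive policy $\psi$ satisfies $$\mathrm{SRegret}(\alpha,\psi,D)\ \ge\ \frac1{32}\min\Big\{\frac1{1-\alpha},\ \sqrt{\frac{1}{2\delta(1-\alpha)}}\Big\},$$ that is, the infimum of $\mathrm{SRegret}(\alpha,\psi,D)$ over all adaptive policies is at least the right-hand side. -/

import Mathlib

open MeasureTheory ProbabilityTheory

/-- The history `(A₀, R₀, …, A_{t-1}, R_{t-1})` available when the action of period `t` is selected.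
Arms are indexed by `ℕ`; the observed outcome of a period is its reward. -/
abbrev History (t : ℕ) : Type := Fin t → ℕ × ℝ

/-- An adaptive (randomized) policy: a sequence of measurable functions, the `t`-th one mapping the
history before period `t` and the value of an exogenous random seed to the arm played in
period `t`. -/
structure AdaptivePolicy (Ξ : Type*) [MeasurableSpace Ξ] where
  act : (t : ℕ) → History t → Ξ → ℕ
  measurable_act : ∀ t, Measurable (fun p : History t × Ξ => act t p.1 p.2)

/-- The realized history before period `t` along given action and reward processes. -/
def realizedHistory {Ω : Type*} (A : ℕ → Ω → ℕ) (R : ℕ → Ω → ℝ) (t : ℕ) (ω : Ω) : History t :=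
  fun s => (A s ω, R s ω)

/-- The sigma-algebra generated by `θ`, the seed `ξ`, the action `A_t` and the history before
period `t`. -/
abbrev preRewardSigma {Ω Ξ : Type*} [MeasurableSpace Ξ] (θ : ℕ → Ω → ℝ) (ξ : Ω → Ξ)
    (A : ℕ → Ω → ℕ) (R : ℕ → Ω → ℝ) (t : ℕ) : MeasurableSpace Ω :=
  MeasurableSpace.comap
    (fun ω => ((fun a => θ a ω), ξ ω, A t ω, realizedHistory A R t ω)) inferInstance

/-- On the probability space `(Ω, P)`, the actions `A` and rewards `R` are those of the policy `ψ`,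
randomized by the seed `ξ`, in the infinite-armed Bernoulli bandit whose arms have the random mean
rewards `θ a`: the means are independent across arms, the seed is independent of the means,
`A_t` is chosen by `ψ` from the history and the seed, and, given everything
that precedes it, `R_t` is a Bernoulli variable with mean `θ_{A_t}`. -/
structure IsBernoulliBanditRun {Ω Ξ : Type*} [MeasurableSpace Ω] [MeasurableSpace Ξ]
    (P : Measure Ω) (ψ : AdaptivePolicy Ξ) (θ : ℕ → Ω → ℝ) (ξ : Ω → Ξ)
    (A : ℕ → Ω → ℕ) (R : ℕ → Ω → ℝ) : Prop where
  measurable_mean : ∀ a, Measurable (θ a)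
  measurable_seed : Measurable ξ
  measurable_reward : ∀ t, Measurable (R t)
  indep_means : iIndepFun θ P
  indep_seed : IndepFun ξ (fun ω a => θ a ω) P
  action_eq : ∀ t ω, A t ω = ψ.act t (realizedHistory A R t ω) (ξ ω)
  reward_mem : ∀ t ω, R t ω = 0 ∨ R t ω = 1
  reward_law : ∀ t, P⟦{ω | R t ω = 1} | preRewardSigma θ ξ A R t⟧ =ᵐ[P] fun ω => θ (A t ω) ω

/-- Expected discounted satisficing regret at level `D`,
`E[∑_t α^t (R* - D - R_t)]` with `R* = sup_a θ_a`. -/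
noncomputable def satisficingRegret {Ω : Type*} [MeasurableSpace Ω] (P : Measure Ω)
    (θ : ℕ → Ω → ℝ) (R : ℕ → Ω → ℝ) (α D : ℝ) : ℝ :=
  ∫ ω, ∑' t : ℕ, α ^ t * ((⨆ a, θ a ω) - D - R t ω) ∂P

/-! Almost surely some arm has mean `1/2 + D`, so `R* - D = 1/2` and the regret is `∑ α^t (Δ U_t - D
T_t)`, where `U_t`, `V_t`, `T_t` are the probabilities that the arm played at `t` has the low,
middle or top mean (`satisficingRegret_eq`). Since `U_t + V_t + T_t = 1`, it suffices to bound `V`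
by `U` and to show that `T` is small.

Both bounds come from a change of measure on one arm (`setIntegral_armLik_swap`): switching the mean
of arm `a` costs only the prior weights and the likelihood of the rewards seen from `a`. For `T`,
the likelihoods are trivial at the first play of an arm, so each period discovers a top arm with
probability at most `ε / (1 - δ)` (`measureReal_top_le`). For `V`, telling a middle arm from a low
one costs information of order `Δ²` per play of the low arm; this bounds `V_t` by `δ / (1 - δ)`
times a combination of `U_t` and `Δ² ∑_{s<t} U_s` (`measureReal_good_le`).

Discounting turns the partial sums into a factor `α / (1 - α)`, and `Δ` is chosen so that `Δ² δ / (1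
- α)` is at most `1/32`. Hence low arms take a fixed share of the discounted plays, each losing `Δ`,
and the regret has order `Δ / (1 - α)` (`le_tsum_discounted_regret`). -/

/-- If `X ⊥ Y` and `Z ⊥ (X, Y)`, then `X ⊥ (Y, Z)`. -/
theorem indepFun_prodMk_of_indepFun {Ω α β γ : Type*} [MeasurableSpace Ω] [MeasurableSpace α]
    [MeasurableSpace β] [MeasurableSpace γ] {P : Measure Ω} [IsProbabilityMeasure P]
    {X : Ω → α} {Y : Ω → β} {Z : Ω → γ} (hX : Measurable X) (hY : Measurable Y)
    (hZ : Measurable Z) (hXY : IndepFun X Y P) (hZXY : IndepFun Z (fun ω => (X ω, Y ω)) P) :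
    IndepFun X (fun ω => (Y ω, Z ω)) P := by
  have hYZ : IndepFun Y Z P := (hZXY.comp measurable_id measurable_snd).symm
  rw [indepFun_iff_map_prod_eq_prod_map_map (by fun_prop) (by fun_prop)] at hXY hYZ ⊢
  have h := (indepFun_iff_map_prod_eq_prod_map_map (by fun_prop) (by fun_prop)).1 hZXY.symm
  rw [hXY] at h
  have := Measure.isProbabilityMeasure_map (μ := P) hX.aemeasurable
  have := Measure.isProbabilityMeasure_map (μ := P) hY.aemeasurable
  have := Measure.isProbabilityMeasure_map (μ := P) hZ.aemeasurable
  rw [hYZ, ← Measure.prodAssoc_prod, ← h, Measure.map_map (by fun_prop) (by fun_prop)]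
  rfl

theorem integral_mul_of_condExp_eq {Ω : Type*} {m m0 : MeasurableSpace Ω} (hm : m ≤ m0)
    {P : Measure Ω} [IsProbabilityMeasure P] {f c g : Ω → ℝ} (hf : Integrable f P)
    (hc : P[f | m] =ᵐ[P] c) (hg : StronglyMeasurable[m] g) {C : ℝ} (hC : ∀ ω, |g ω| ≤ C) :
    ∫ ω, f ω * g ω ∂P = ∫ ω, c ω * g ω ∂P := by
  have h := condExp_stronglyMeasurable_mul_of_bound hm (μ := P) hg hf C (.of_forall hC)
  calc ∫ ω, f ω * g ω ∂P = ∫ ω, (g * f) ω ∂P := by simp [mul_comm]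
    _ = ∫ ω, (P[g * f | m]) ω ∂P := (integral_condExp hm).symm
    _ = ∫ ω, c ω * g ω ∂P := by
      refine integral_congr_ae ?_
      filter_upwards [h, hc] with ω h1 h2
      rw [h1, Pi.mul_apply, h2, mul_comm]

/-! ### Measurability of a run, and the law of one reward -/

theorem realizedHistory_succ {Ω : Type*} (A : ℕ → Ω → ℕ) (R : ℕ → Ω → ℝ) (t : ℕ) (ω : Ω) :
    realizedHistory A R (t + 1) ω =
      Fin.snoc (α := fun _ => ℕ × ℝ) (realizedHistory A R t ω) (A t ω, R t ω) := by
  funext i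
  refine Fin.lastCases ?_ (fun j => ?_) i <;> simp [realizedHistory]

theorem measurable_snoc {X : Type*} [MeasurableSpace X] {t : ℕ} {H : X → History t}
    {z : X → ℕ × ℝ} (hH : Measurable H) (hz : Measurable z) :
    Measurable (fun x => (Fin.snoc (α := fun _ => ℕ × ℝ) (H x) (z x) : History (t + 1))) := by
  refine measurable_pi_lambda _ fun i => ?_
  refine Fin.lastCases ?_ (fun j => ?_) i
  · simpa using hz
  · simp only [Fin.snoc_castSucc]
    exact (measurable_pi_apply j).comp hH

section Run

variable {Ω Ξ : Type*} {mΩ : MeasurableSpace Ω} [MeasurableSpace Ξ] {P : Measure Ω}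
  {ψ : AdaptivePolicy Ξ} {θ : ℕ → Ω → ℝ} {ξ : Ω → Ξ}
  {A : ℕ → Ω → ℕ} {R : ℕ → Ω → ℝ}

namespace IsBernoulliBanditRun

variable (h : IsBernoulliBanditRun P ψ θ ξ A R)
include h

theorem measurable_history (t : ℕ) : Measurable (realizedHistory A R t) := by
  induction t with
  | zero => exact measurable_pi_lambda _ fun i => i.elim0
  | succ t ih =>
    simp only [funext (realizedHistory_succ A R t)]
    have hA : Measurable (A t) := by
      rw [funext (h.action_eq t)]
      exact (ψ.measurable_act t).comp (ih.prodMk h.measurable_seed)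
    exact measurable_snoc ih (hA.prodMk (h.measurable_reward t))

theorem measurable_action (t : ℕ) : Measurable (A t) := by
  rw [funext (h.action_eq t)]
  exact (ψ.measurable_act t).comp ((h.measurable_history t).prodMk h.measurable_seed)

theorem measurable_means : Measurable (fun ω a => θ a ω) :=
  measurable_pi_lambda _ h.measurable_mean

theorem preRewardSigma_le (t : ℕ) : preRewardSigma θ ξ A R t ≤ mΩ := by
  refine Measurable.comap_le ?_
  exact h.measurable_means.prodMk (h.measurable_seed.prodMk
    ((h.measurable_action t).prodMk (h.measurable_history t)))

theorem measurable_mean_action (t : ℕ) : Measurable (fun ω => θ (A t ω) ω) := by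
  have : Measurable (fun p : (ℕ → ℝ) × ℕ => p.1 p.2) :=
    measurable_from_prod_countable_left fun n => measurable_pi_apply n
  exact this.comp (h.measurable_means.prodMk (h.measurable_action t))

/-- The test function may look at all the means, which lets later arguments restrict to events such
as `θ a = x`. -/
theorem integral_reward_mul [IsProbabilityMeasure P] (t : ℕ) {g : (ℕ → ℝ) × Ξ × History t → ℝ} (hg : Measurable g)
    {C : ℝ} (hC : ∀ z, |g z| ≤ C) :
    ∫ ω, R t ω * g (fun a => θ a ω, ξ ω, realizedHistory A R t ω) ∂P =
      ∫ ω, θ (A t ω) ω * g (fun a => θ a ω, ξ ω, realizedHistory A R t ω) ∂P := by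
  have hR : R t = {ω | R t ω = 1}.indicator fun _ => (1 : ℝ) := by
    funext ω
    rcases h.reward_mem t ω with h0 | h0 <;> simp [Set.indicator, h0]
  have hS : MeasurableSet {ω | R t ω = 1} := h.measurable_reward t (measurableSet_singleton 1)
  refine integral_mul_of_condExp_eq (h.preRewardSigma_le t) (f := R t) ?_ ?_ ?_ (fun ω => hC _)
  · rw [hR]; exact (integrable_const 1).indicator hS
  · have := h.reward_law t
    rw [← hR] at this
    exact this
  · refine Measurable.stronglyMeasurable ?_
    have h1 : Measurable (fun p : (ℕ → ℝ) × Ξ × ℕ × History t => g (p.1, p.2.1, p.2.2.2)) :=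
      hg.comp (by fun_prop)
    exact h1.comp (comap_measurable _)

/-- Overwriting coordinate `a` by `0` encodes "the means of all other arms" without leaving the type
`ℕ → ℝ`. -/
theorem indepFun_mean_update_seed [IsProbabilityMeasure P] (a : ℕ) :
    IndepFun (θ a) (fun ω => (Function.update (fun b => θ b ω) a 0, ξ ω)) P := by
  have hupd : Measurable (fun ω => Function.update (fun b => θ b ω) a (0 : ℝ)) := by
    refine measurable_pi_lambda _ fun b => ?_
    by_cases hb : b = a
    · subst hb; simp
    · simpa [hb] using h.measurable_mean b
  refine indepFun_prodMk_of_indepFun (h.measurable_mean a) hupd h.measurable_seed ?_ ?_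
  · have hi := indep_iSup_of_disjoint (m := fun b => MeasurableSpace.comap (θ b) inferInstance)
      (fun b => (h.measurable_mean b).comap_le) h.indep_means.iIndep
      (S := {a}) (T := {a}ᶜ) disjoint_compl_right
    rw [IndepFun_iff_Indep]
    refine indep_of_indep_of_le_left (indep_of_indep_of_le_right hi ?_) ?_
    · refine Measurable.comap_le ?_
      refine @measurable_pi_lambda _ _ _ (_) _ _ fun b => ?_
      by_cases hb : b = a
      · subst hb
        simp only [Function.update_self]
        exact @measurable_const _ _ _ (_) _
      · simp only [ne_eq, hb, not_false_eq_true, Function.update_of_ne]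
        refine Measurable.mono (comap_measurable (θ b)) ?_ le_rfl
        exact le_iSup₂_of_le b hb le_rfl
    · exact le_iSup₂_of_le a rfl le_rfl
  · refine h.indep_seed.comp measurable_id (ψ := fun v : ℕ → ℝ => (v a, Function.update v a 0)) ?_
    refine (measurable_pi_apply a).prodMk (measurable_pi_lambda _ fun b => ?_)
    by_cases hb : b = a
    · subst hb; simp
    · simpa [hb] using measurable_pi_apply b

end IsBernoulliBanditRun

end Run

/-! ### Change of measure for the mean of one arm -/

/-- The likelihood of the rewards that the history shows for arm `a`, when its mean is `x`. -/
noncomputable def armLik (a : ℕ) (x : ℝ) {t : ℕ} (H : History t) : ℝ :=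
  ∏ s, if (H s).1 = a then (if (H s).2 = 1 then x else 1 - x) else 1

theorem armLik_snoc (a : ℕ) (x : ℝ) {t : ℕ} (H : History t) (k : ℕ) (r : ℝ) :
    armLik a x (Fin.snoc (α := fun _ => ℕ × ℝ) H (k, r) : History (t + 1)) =
      armLik a x H * if k = a then (if r = 1 then x else 1 - x) else 1 := by
  simp [armLik, Fin.prod_univ_castSucc]

theorem measurable_armLik (a : ℕ) (x : ℝ) (t : ℕ) :
    Measurable (armLik a x : History t → ℝ) := by
  refine Finset.measurable_fun_prod _ fun s _ => ?_
  have h1 : MeasurableSet {H : History t | (H s).1 = a} :=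
    (measurable_fst.comp (measurable_pi_apply s)) (measurableSet_singleton a)
  have h2 : MeasurableSet {H : History t | (H s).2 = 1} :=
    (measurable_snd.comp (measurable_pi_apply s)) (measurableSet_singleton (1 : ℝ))
  exact Measurable.ite h1 (Measurable.ite h2 measurable_const measurable_const) measurable_const

theorem armLik_nonneg (a : ℕ) {x : ℝ} (hx : x ∈ Set.Icc (0 : ℝ) 1) {t : ℕ} (H : History t) :
    0 ≤ armLik a x H := by
  refine Finset.prod_nonneg fun s _ => ?_
  split_ifs <;> linarith [hx.1, hx.2]

theorem armLik_le_one (a : ℕ) {x : ℝ} (hx : x ∈ Set.Icc (0 : ℝ) 1) {t : ℕ} (H : History t) :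
    armLik a x H ≤ 1 := by
  refine Finset.prod_le_one (fun s _ => ?_) (fun s _ => ?_) <;>
  split_ifs <;> linarith [hx.1, hx.2]

theorem pow_le_armLik (a : ℕ) {x : ℝ} (hx : x ∈ Set.Icc (1 / 4 : ℝ) (3 / 4)) {t : ℕ}
    (H : History t) : (1 / 4 : ℝ) ^ t ≤ armLik a x H := by
  have : (1 / 4 : ℝ) ^ t = ∏ _s : Fin t, (1 / 4 : ℝ) := by simp
  rw [this]
  refine Finset.prod_le_prod (fun s _ => by norm_num) (fun s _ => ?_)
  split_ifs <;> linarith [hx.1, hx.2]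

theorem measurable_update_zero (a : ℕ) :
    Measurable (fun v : ℕ → ℝ => Function.update v a 0) := by
  refine measurable_pi_lambda _ fun b => ?_
  by_cases hb : b = a
  · subst hb; simp
  · simpa [hb] using measurable_pi_apply b

theorem abs_le_of_mem_Icc_mul {p q C : ℝ} (hp : p ∈ Set.Icc (0 : ℝ) 1) (hq : |q| ≤ C) :
    |p * q| ≤ C := by
  rw [abs_mul, abs_of_nonneg hp.1]
  exact (mul_le_of_le_one_left (abs_nonneg q) hp.2).trans hq

namespace IsBernoulliBanditRun

variable {Ω Ξ : Type*} {mΩ : MeasurableSpace Ω} [MeasurableSpace Ξ] {P : Measure Ω}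
  [IsProbabilityMeasure P] {ψ : AdaptivePolicy Ξ} {θ : ℕ → Ω → ℝ} {ξ : Ω → Ξ}
  {A : ℕ → Ω → ℕ} {R : ℕ → Ω → ℝ} (h : IsBernoulliBanditRun P ψ θ ξ A R)
include h

omit [IsProbabilityMeasure P] in
theorem measurableSet_mean_eq (a : ℕ) (x : ℝ) : MeasurableSet {ω | θ a ω = x} :=
  h.measurable_mean a (measurableSet_singleton x)

theorem setIntegral_reward_mul (a : ℕ) (x : ℝ) (t : ℕ) {g : (ℕ → ℝ) × Ξ × History t → ℝ}
    (hg : Measurable g) {C : ℝ} (hC : ∀ z, |g z| ≤ C) :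
    ∫ ω in {ω | θ a ω = x}, R t ω * g (fun b => θ b ω, ξ ω, realizedHistory A R t ω) ∂P =
      ∫ ω in {ω | θ a ω = x},
        θ (A t ω) ω * g (fun b => θ b ω, ξ ω, realizedHistory A R t ω) ∂P := by
  have hS : MeasurableSet {z : (ℕ → ℝ) × Ξ × History t | z.1 a = x} :=
    measurableSet_eq_fun ((measurable_pi_apply a).comp measurable_fst) measurable_const
  have hb : ∀ z, |({z : (ℕ → ℝ) × Ξ × History t | z.1 a = x}.indicator g) z| ≤ C := by
    intro z
    by_cases hz : z ∈ {z : (ℕ → ℝ) × Ξ × History t | z.1 a = x}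
    · simpa [hz] using hC z
    · simpa [hz] using (abs_nonneg _).trans (hC z)
  have := h.integral_reward_mul t (hg.indicator hS) hb
  rw [← integral_indicator (h.measurableSet_mean_eq a x),
    ← integral_indicator (h.measurableSet_mean_eq a x)]
  convert this using 3 with ω ω <;>
  · by_cases hω : θ a ω = x <;> simp [Set.indicator, hω]

theorem integrable_comp_of_bound (t : ℕ) {g : (ℕ → ℝ) × Ξ × History t → ℝ}
    (hg : Measurable g) {C : ℝ} (hC : ∀ z, |g z| ≤ C) :
    Integrable (fun ω => g (fun b => θ b ω, ξ ω, realizedHistory A R t ω)) P :=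
  Integrable.of_bound (hg.comp (h.measurable_means.prodMk
    (h.measurable_seed.prodMk (h.measurable_history t)))).aestronglyMeasurable C
    (.of_forall fun _ => hC _)

omit [IsProbabilityMeasure P] in
theorem reward_mem_Icc (t : ℕ) (ω : Ω) : R t ω ∈ Set.Icc (0 : ℝ) 1 := by
  rcases h.reward_mem t ω with h0 | h0 <;> simp [h0]

/-- Any function of a binary reward has the form `R g₁ + (1 - R) g₀`, so this integrates out the
last reward. -/
theorem setIntegral_reward_mix (a : ℕ) (x : ℝ) (t : ℕ)
    {g₁ g₀ : (ℕ → ℝ) × Ξ × History t → ℝ} (hg₁ : Measurable g₁) (hg₀ : Measurable g₀) {C : ℝ}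
    (hC₁ : ∀ z, |g₁ z| ≤ C) (hC₀ : ∀ z, |g₀ z| ≤ C) :
    ∫ ω in {ω | θ a ω = x}, (R t ω * g₁ (fun b => θ b ω, ξ ω, realizedHistory A R t ω) +
        (1 - R t ω) * g₀ (fun b => θ b ω, ξ ω, realizedHistory A R t ω)) ∂P =
      ∫ ω in {ω | θ a ω = x},
        (θ (A t ω) ω * g₁ (fun b => θ b ω, ξ ω, realizedHistory A R t ω) +
        (1 - θ (A t ω) ω) * g₀ (fun b => θ b ω, ξ ω, realizedHistory A R t ω)) ∂P := by
  have hd : ∀ z, |g₁ z - g₀ z| ≤ C + C := fun z => (abs_sub _ _).trans (add_le_add (hC₁ z) (hC₀ z))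
  have hgd : Measurable fun z => g₁ z - g₀ z := hg₁.sub hg₀
  have e : ∀ r p q : ℝ, r * p + (1 - r) * q = r * (p - q) + q := fun r p q => by ring
  simp only [e]
  have hid := h.integrable_comp_of_bound t hgd hd
  have hi0 := (h.integrable_comp_of_bound t hg₀ hC₀).integrableOn (s := {ω | θ a ω = x})
  have hθ : Integrable (fun ω => θ (A t ω) ω) P := integrable_condExp.congr (h.reward_law t)
  have hR : Integrable (R t) P :=
    Integrable.of_bound (h.measurable_reward t).aestronglyMeasurable 1 (.of_forall fun ω => by
      rw [Real.norm_eq_abs, abs_of_nonneg (h.reward_mem_Icc t ω).1]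
      exact (h.reward_mem_Icc t ω).2)
  rw [integral_add ((hR.mul_bdd hid.aestronglyMeasurable (.of_forall fun _ => hd _)).integrableOn)
      hi0,
    integral_add ((hθ.mul_bdd hid.aestronglyMeasurable (.of_forall fun _ => hd _)).integrableOn)
      hi0, h.setIntegral_reward_mul a x t hgd hd]

/-- Exchanging the value of the mean of arm `a` costs the ratio of the prior weights and of the
likelihoods of the rewards observed from this arm. -/
theorem setIntegral_armLik_swap (h01 : ∀ᵐ ω ∂P, ∀ a, θ a ω ∈ Set.Icc (0 : ℝ) 1) (a : ℕ)
    {x y : ℝ} (hx : x ∈ Set.Icc (0 : ℝ) 1) (hy : y ∈ Set.Icc (0 : ℝ) 1) (t : ℕ)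
    {f : (ℕ → ℝ) × Ξ × History t → ℝ} (hf : Measurable f) {C : ℝ} (hC : ∀ z, |f z| ≤ C) :
    P.real {ω | θ a ω = y} * ∫ ω in {ω | θ a ω = x}, armLik a y (realizedHistory A R t ω) *
        f (Function.update (fun b => θ b ω) a 0, ξ ω, realizedHistory A R t ω) ∂P =
      P.real {ω | θ a ω = x} * ∫ ω in {ω | θ a ω = y}, armLik a x (realizedHistory A R t ω) *
        f (Function.update (fun b => θ b ω) a 0, ξ ω, realizedHistory A R t ω) ∂P := by
  induction t generalizing C with
  | zero =>
    -- With an empty history only the seed and the other means remain, and these are independent of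
    -- `θ a`.
    have key : ∀ x, ∫ ω in {ω | θ a ω = x},
        f (Function.update (fun b => θ b ω) a 0, ξ ω, realizedHistory A R 0 ω) ∂P =
        P.real {ω | θ a ω = x} *
        ∫ ω, f (Function.update (fun b => θ b ω) a 0, ξ ω, realizedHistory A R 0 ω) ∂P := by
      intro x
      have hH : ∀ ω, realizedHistory A R 0 ω = fun s => s.elim0 :=
        fun ω => funext fun s => s.elim0
      simp only [hH]
      have hm : Measurable fun p : (ℕ → ℝ) × Ξ => f (p.1, p.2, fun s => s.elim0) :=
        hf.comp (by fun_prop)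
      have hi : Measurable (({x} : Set ℝ).indicator (1 : ℝ → ℝ)) :=
        measurable_one.indicator (measurableSet_singleton x)
      have := ((h.indepFun_mean_update_seed a).comp hi hm).integral_fun_mul_eq_mul_integral
        (hi.comp (h.measurable_mean a)).aestronglyMeasurable
        (hm.comp (((measurable_update_zero a).comp h.measurable_means).prodMk
          h.measurable_seed)).aestronglyMeasurable
      rw [← integral_indicator_one (h.measurableSet_mean_eq a x),
        ← integral_indicator (h.measurableSet_mean_eq a x)]
      refine Eq.trans (integral_congr_ae (.of_forall fun ω => ?_)) this
      by_cases hω : θ a ω = x <;> simp [hω]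
    have hl : ∀ x, ∀ H : History 0, armLik a x H = 1 := fun x H => by simp [armLik]
    simp only [hl, one_mul, key]
    ring
  | succ t ih =>
    let act : (ℕ → ℝ) × Ξ × History t → ℕ := fun z => ψ.act t z.2.2 z.2.1
    have hact : Measurable act := (ψ.measurable_act t).comp
      ((measurable_snd.comp measurable_snd).prodMk (measurable_fst.comp measurable_snd))
    have hactS : MeasurableSet {z | act z = a} := hact (measurableSet_singleton a)
    let fr : ℝ → (ℕ → ℝ) × Ξ × History t → ℝ := fun r z =>
      f (z.1, z.2.1, Fin.snoc (α := fun _ => ℕ × ℝ) z.2.2 (act z, r))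
    have hfr : ∀ r, Measurable (fr r) := fun r => hf.comp (measurable_fst.prodMk
      ((measurable_fst.comp measurable_snd).prodMk (measurable_snoc
        (measurable_snd.comp measurable_snd) (hact.prodMk measurable_const))))
    have hfrC : ∀ r z, |fr r z| ≤ C := fun r z => hC _
    -- The means lie in `[0, 1]` only almost surely; truncation gives a bound at every point, as the
    -- induction hypothesis requires.
    let cl : (ℕ → ℝ) × Ξ × History t → ℝ := fun z => max 0 (min 1 (z.1 (act z)))
    have hcl : Measurable cl := by
      have : Measurable (fun p : (ℕ → ℝ) × ℕ => p.1 p.2) :=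
        measurable_from_prod_countable_left fun n => measurable_pi_apply n
      exact measurable_const.max (measurable_const.min
        (this.comp (measurable_fst.prodMk hact)))
    have hcl01 : ∀ z, cl z ∈ Set.Icc (0 : ℝ) 1 := fun z =>
      ⟨le_max_left _ _, max_le zero_le_one (min_le_left _ _)⟩
    -- The result of integrating out `R t`: a play of `a` contributes the true probability of the
    -- reward times its likelihood under the other value. These products are symmetric in `x` and
    -- `y`, which drives the induction.
    let F : ℝ → ℝ → (ℕ → ℝ) × Ξ × History t → ℝ := fun x y z =>
      (if act z = a then x * y else cl z) * fr 1 z +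
        (if act z = a then (1 - x) * (1 - y) else 1 - cl z) * fr 0 z
    have hF : ∀ x y, Measurable (F x y) := fun x y =>
      ((Measurable.ite hactS measurable_const hcl).mul (hfr 1)).add
        ((Measurable.ite hactS measurable_const (measurable_const.sub hcl)).mul (hfr 0))
    have hFC : ∀ {x y}, x ∈ Set.Icc (0 : ℝ) 1 → y ∈ Set.Icc (0 : ℝ) 1 → ∀ z,
        |F x y z| ≤ C + C := by
      intro x y hx hy z
      refine (abs_add_le _ _).trans (add_le_add (abs_le_of_mem_Icc_mul ?_ (hfrC 1 z))
        (abs_le_of_mem_Icc_mul ?_ (hfrC 0 z)))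
      · split_ifs
        · exact ⟨mul_nonneg hx.1 hy.1, mul_le_one₀ hx.2 hy.1 hy.2⟩
        · exact hcl01 z
      · split_ifs
        · exact ⟨mul_nonneg (by linarith [hx.2]) (by linarith [hy.2]),
            mul_le_one₀ (by linarith [hx.1]) (by linarith [hy.2]) (by linarith [hy.1])⟩
        · exact ⟨by linarith [(hcl01 z).2], by linarith [(hcl01 z).1]⟩
    have hFsymm : ∀ x y, F x y = F y x := fun x y => by
      funext z; simp only [F, mul_comm x y, mul_comm (1 - x) (1 - y)]
    have step : ∀ {x y}, x ∈ Set.Icc (0 : ℝ) 1 → y ∈ Set.Icc (0 : ℝ) 1 →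
        ∫ ω in {ω | θ a ω = x}, armLik a y (realizedHistory A R (t + 1) ω) *
          f (Function.update (fun b => θ b ω) a 0, ξ ω, realizedHistory A R (t + 1) ω) ∂P =
        ∫ ω in {ω | θ a ω = x}, armLik a y (realizedHistory A R t ω) *
          F x y (Function.update (fun b => θ b ω) a 0, ξ ω, realizedHistory A R t ω) ∂P := by
      intro x y hx hy
      -- `r` is the value of the new reward and `q` its likelihood under mean `y`, counted only if
      -- `a` is played.
      let G : ℝ → ℝ → (ℕ → ℝ) × Ξ × History t → ℝ := fun q r z =>
        armLik a y z.2.2 * ((if act z = a then q else 1) *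
          fr r (Function.update z.1 a 0, z.2.1, z.2.2))
      have hG : ∀ q r, Measurable (G q r) := fun q r =>
        ((measurable_armLik a y t).comp (measurable_snd.comp measurable_snd)).mul
          ((Measurable.ite hactS measurable_const measurable_const).mul
            ((hfr r).comp (((measurable_update_zero a).comp measurable_fst).prodMk measurable_snd)))
      have hGC : ∀ q r, q ∈ Set.Icc (0 : ℝ) 1 → ∀ z, |G q r z| ≤ C := fun q r hq z => by
        refine abs_le_of_mem_Icc_mul ⟨armLik_nonneg a hy _, armLik_le_one a hy _⟩
          (abs_le_of_mem_Icc_mul ?_ (hfrC _ _))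
        split_ifs
        · exact hq
        · simp
      have hmix := h.setIntegral_reward_mix a x t (hG y 1) (hG (1 - y) 0)
        (hGC y 1 hy) (hGC (1 - y) 0 ⟨by linarith [hy.2], by linarith [hy.1]⟩)
      refine Eq.trans ?_ (hmix.trans ?_)
      · refine setIntegral_congr_fun (h.measurableSet_mean_eq a x) fun ω _ => ?_
        have hA : act (fun b => θ b ω, ξ ω, realizedHistory A R t ω) = A t ω :=
          (h.action_eq t ω).symm
        have hA' : act (Function.update (fun b => θ b ω) a 0, ξ ω, realizedHistory A R t ω) =
          A t ω := (h.action_eq t ω).symm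
        simp only [G, fr, hA, hA', realizedHistory_succ, armLik_snoc]
        rcases h.reward_mem t ω with h0 | h0 <;> simp [h0] <;> ring_nf
      · refine setIntegral_congr_ae (h.measurableSet_mean_eq a x) ?_
        filter_upwards [h01] with ω hω hωx
        have hA : act (fun b => θ b ω, ξ ω, realizedHistory A R t ω) = A t ω :=
          (h.action_eq t ω).symm
        have hA' : act (Function.update (fun b => θ b ω) a 0, ξ ω, realizedHistory A R t ω) =
          A t ω := (h.action_eq t ω).symm
        simp only [G, F, fr, cl, hA, hA']
        by_cases hAa : A t ω = a
        · have : θ a ω = x := hωx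
          simp only [hAa, this, if_true]
          ring
        · have : max 0 (min 1 (θ (A t ω) ω)) = θ (A t ω) ω := by
            rw [min_eq_right (hω _).2, max_eq_right (hω _).1]
          simp only [hAa, if_false, ne_eq, not_false_eq_true, Function.update_of_ne, this]
          ring
    rw [step hx hy, step hy hx, ih (hF x y) (hFC hx hy), hFsymm x y]

end IsBernoulliBanditRun

/-! ### Plays of a middle arm against plays of a low arm -/

/-- A pointwise substitute for an information inequality: `L` is a likelihood ratio, so `L - 1`
integrates to zero, and the integral of `W` is explicit. -/
theorem mul_indicator_le_of_exp_neg_le {L W X : ℝ} (hX : X = 0 ∨ X = 1)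
    (hL : Real.exp (-W) ≤ L) : 3 / 4 * (L * X) ≤ 5 / 4 * X + 2 * (L - 1) + 2 * W := by
  have h1 := Real.add_one_le_exp (-W)
  rcases hX with rfl | rfl
  · linarith
  · have h2 := Real.add_one_le_exp (-W / 2)
    have h3 : Real.exp (-W) = Real.exp (-W / 2) ^ 2 := by
      rw [← Real.exp_nat_mul]; congr 1; push_cast; ring
    -- With `y = exp (-W / 2) ≥ 1 - W / 2`, it remains that `5/4 y² - 4 y + 13/4 ≥ 0`; the minimum,
    -- at `y = 8/5`, is `1/20`.
    nlinarith [sq_nonneg (Real.exp (-W / 2) - 8 / 5)]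

/-- The log-likelihood ratio of arm `a` between the means `1 / 2 - Δ` and `1 / 2`, linearized. -/
noncomputable def linearLogLik (a : ℕ) (Δ : ℝ) {t : ℕ} (H : History t) : ℝ :=
  ∑ s, if (H s).1 = a then 2 * Δ * (1 - 2 * (H s).2) else 0

/-- Factor by factor this is `exp (-2Δ) ≤ 1 / (1 + 2Δ)` for a reward `0` and `exp (2Δ) ≤ 1 / (1 -
2Δ)` for a reward `1`. -/
theorem exp_neg_linearLogLik_le (a : ℕ) {Δ : ℝ} (hΔ : Δ ∈ Set.Icc (0 : ℝ) (1 / 4)) {t : ℕ}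
    {H : History t} (hH : ∀ s, (H s).2 = 0 ∨ (H s).2 = 1) :
    Real.exp (-linearLogLik a Δ H) ≤ armLik a (1 / 2) H / armLik a (1 / 2 - Δ) H := by
  have hpos : 0 < armLik a (1 / 2 - Δ) H :=
    (by positivity : (0 : ℝ) < (1 / 4) ^ t).trans_le
      (pow_le_armLik a ⟨by linarith [hΔ.2], by linarith [hΔ.1]⟩ H)
  rw [le_div_iff₀ hpos, linearLogLik, ← Finset.sum_neg_distrib, Real.exp_sum, armLik, armLik,
    ← Finset.prod_mul_distrib]
  refine Finset.prod_le_prod (fun s _ => mul_nonneg (Real.exp_pos _).le ?_) (fun s _ => ?_)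
  · split_ifs <;> linarith [hΔ.1, hΔ.2]
  · by_cases ha : (H s).1 = a
    · rcases hH s with h0 | h0
      · have h1 := Real.add_one_le_exp (2 * Δ)
        have h2 : Real.exp (-(2 * Δ)) * Real.exp (2 * Δ) = 1 := by
          rw [← Real.exp_add]; simp
        have h3 := mul_le_mul_of_nonneg_left h1 (Real.exp_pos (-(2 * Δ))).le
        simp only [ha, h0, if_true, zero_ne_one, if_false, mul_zero, sub_zero, mul_one]
        linarith
      · have h1 := Real.add_one_le_exp (-(2 * Δ))
        have h2 : Real.exp (2 * Δ) * Real.exp (-(2 * Δ)) = 1 := by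
          rw [← Real.exp_add]; simp
        have h3 := mul_le_mul_of_nonneg_left h1 (Real.exp_pos (2 * Δ)).le
        simp only [ha, h0, if_true]
        rw [show -(2 * Δ * (1 - 2 * 1)) = 2 * Δ by ring]
        linarith
    · simp [ha]

namespace IsBernoulliBanditRun

variable {Ω Ξ : Type*} {mΩ : MeasurableSpace Ω} [MeasurableSpace Ξ] {P : Measure Ω}
  [IsProbabilityMeasure P] {ψ : AdaptivePolicy Ξ} {θ : ℕ → Ω → ℝ} {ξ : Ω → Ξ}
  {A : ℕ → Ω → ℕ} {R : ℕ → Ω → ℝ} (h : IsBernoulliBanditRun P ψ θ ξ A R)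
include h

/-- The exchange identity applied to `φ` divided by the likelihood under `y`; keeping `y` away from
`0` and `1` makes this quotient bounded. -/
theorem setIntegral_eq_armLik_ratio (h01 : ∀ᵐ ω ∂P, ∀ a, θ a ω ∈ Set.Icc (0 : ℝ) 1) (a : ℕ)
    {x y : ℝ} (hx : x ∈ Set.Icc (0 : ℝ) 1) (hy : y ∈ Set.Icc (1 / 4 : ℝ) (3 / 4)) (t : ℕ)
    {φ : Ξ × History t → ℝ} (hφ : Measurable φ) {C : ℝ} (hC : ∀ z, |φ z| ≤ C) :
    P.real {ω | θ a ω = y} * ∫ ω in {ω | θ a ω = x}, φ (ξ ω, realizedHistory A R t ω) ∂P =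
      P.real {ω | θ a ω = x} * ∫ ω in {ω | θ a ω = y},
        armLik a x (realizedHistory A R t ω) / armLik a y (realizedHistory A R t ω) *
          φ (ξ ω, realizedHistory A R t ω) ∂P := by
  have hlb := fun H : History t => pow_le_armLik a hy H
  have hp : (0 : ℝ) < (1 / 4) ^ t := by positivity
  have hm : Measurable fun z : (ℕ → ℝ) × Ξ × History t => φ z.2 / armLik a y z.2.2 :=
    (hφ.comp measurable_snd).div
      ((measurable_armLik a y t).comp (measurable_snd.comp measurable_snd))
  have hb : ∀ z : (ℕ → ℝ) × Ξ × History t, |φ z.2 / armLik a y z.2.2| ≤ C / (1 / 4) ^ t := by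
    intro z
    rw [abs_div, abs_of_pos (hp.trans_le (hlb _))]
    exact div_le_div₀ ((abs_nonneg _).trans (hC z.2)) (hC _) hp (hlb _)
  have := h.setIntegral_armLik_swap h01 a (y := y) hx
    ⟨by linarith [hy.1], by linarith [hy.2]⟩ t hm hb
  convert this using 3
  · funext ω
    have := (hp.trans_le (hlb (realizedHistory A R t ω))).ne'
    field_simp
  · funext ω
    ring

/-- A play of an arm with mean `1/2 - Δ` adds on average `2Δ (1 - 2 (1/2 - Δ)) = 4Δ²`. -/
theorem setIntegral_linearLogLik (a : ℕ) (Δ : ℝ) (t : ℕ) :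
    Integrable (fun ω => linearLogLik a Δ (realizedHistory A R t ω)) P ∧
    ∫ ω in {ω | θ a ω = 1 / 2 - Δ}, linearLogLik a Δ (realizedHistory A R t ω) ∂P =
      4 * Δ ^ 2 * ∑ s : Fin t, P.real ({ω | θ a ω = 1 / 2 - Δ} ∩ {ω | A s ω = a}) := by
  have hS : ∀ s, MeasurableSet {ω | A s ω = a} := fun s =>
    h.measurable_action s (measurableSet_singleton a)
  have hint : ∀ s, Integrable
      (fun ω => if A s ω = a then 2 * Δ * (1 - 2 * R s ω) else 0) P := by
    intro s
    refine Integrable.of_bound (C := |2 * Δ|) (Measurable.aestronglyMeasurable ?_)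
      (.of_forall fun ω => ?_)
    · exact Measurable.ite (hS s) (measurable_const.mul (measurable_const.sub
        (measurable_const.mul (h.measurable_reward s)))) measurable_const
    · rcases h.reward_mem s ω with h0 | h0 <;> split_ifs <;> norm_num [h0, abs_mul]
  refine ⟨integrable_finsetSum _ fun s _ => hint s, ?_⟩
  have hlin : ∀ ω, linearLogLik a Δ (realizedHistory A R t ω) =
      ∑ s : Fin t, if A s ω = a then 2 * Δ * (1 - 2 * R s ω) else 0 := fun ω => rfl
  simp only [hlin]
  rw [integral_finsetSum _ fun (s : Fin t) _ => (hint s).integrableOn, Finset.mul_sum]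
  refine Finset.sum_congr rfl fun s _ => ?_
  let g : ℝ → (ℕ → ℝ) × Ξ × History s → ℝ := fun c z => if ψ.act s z.2.2 z.2.1 = a then c else 0
  have hg : ∀ c, Measurable (g c) := fun c =>
    Measurable.ite (((ψ.measurable_act s).comp ((measurable_snd.comp measurable_snd).prodMk
      (measurable_fst.comp measurable_snd))) (measurableSet_singleton a))
      measurable_const measurable_const
  have hgC : ∀ c z, |g c z| ≤ |c| := fun c z => by
    simp only [g]; split_ifs <;> simp
  have hmix := h.setIntegral_reward_mix a (1 / 2 - Δ) s (hg (-(2 * Δ))) (hg (2 * Δ))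
    (C := |2 * Δ|) (fun z => (hgC _ z).trans (abs_neg _).le) (hgC _)
  simp only [g, ← h.action_eq] at hmix
  have h1 : ∫ ω in {ω | θ a ω = 1 / 2 - Δ}, {ω | A s ω = a}.indicator (fun _ => 4 * Δ ^ 2) ω ∂P =
      4 * Δ ^ 2 * P.real ({ω | θ a ω = 1 / 2 - Δ} ∩ {ω | A s ω = a}) := by
    rw [setIntegral_indicator (hS s)]
    simp [mul_comm]
  rw [← h1]
  refine Eq.trans ?_ (hmix.trans ?_)
  · refine integral_congr_ae (.of_forall fun ω => ?_)
    by_cases ha : A s ω = a <;> simp only [ha, if_true, if_false] <;> ring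
  · refine setIntegral_congr_fun (h.measurableSet_mean_eq a _) fun ω hω => ?_
    have hω : θ a ω = 1 / 2 - Δ := hω
    by_cases ha : A s ω = a <;> simp [ha, hω]
    ring

/-- The plays of arm `a` when it is good are controlled by its plays when it is bad. -/
theorem measureReal_play_good_le (h01 : ∀ᵐ ω ∂P, ∀ a, θ a ω ∈ Set.Icc (0 : ℝ) 1) (a : ℕ)
    {Δ : ℝ} (hΔ : Δ ∈ Set.Icc (0 : ℝ) (1 / 4)) (t : ℕ) :
    P.real {ω | θ a ω = 1 / 2 - Δ} *
        (3 / 4 * P.real ({ω | θ a ω = 1 / 2} ∩ {ω | A t ω = a})) ≤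
      P.real {ω | θ a ω = 1 / 2} *
        (5 / 4 * P.real ({ω | θ a ω = 1 / 2 - Δ} ∩ {ω | A t ω = a}) +
          8 * Δ ^ 2 * ∑ s : Fin t, P.real ({ω | θ a ω = 1 / 2 - Δ} ∩ {ω | A s ω = a})) := by
  have hS : MeasurableSet {ω | A t ω = a} := h.measurable_action t (measurableSet_singleton a)
  have hy : 1 / 2 - Δ ∈ Set.Icc (1 / 4 : ℝ) (3 / 4) := ⟨by linarith [hΔ.2], by linarith [hΔ.1]⟩
  have hhalf : (1 / 2 : ℝ) ∈ Set.Icc (0 : ℝ) 1 := ⟨by norm_num, by norm_num⟩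
  let X : Ξ × History t → ℝ := fun z => if ψ.act t z.2 z.1 = a then 1 else 0
  have hX : Measurable X := Measurable.ite (((ψ.measurable_act t).comp
    (measurable_snd.prodMk measurable_fst)) (measurableSet_singleton a))
    measurable_const measurable_const
  have hX1 : ∀ z, |X z| ≤ 1 := fun z => by simp only [X]; split_ifs <;> simp
  have hXint : ∀ x, ∫ ω in {ω | θ a ω = x}, X (ξ ω, realizedHistory A R t ω) ∂P =
      P.real ({ω | θ a ω = x} ∩ {ω | A t ω = a}) := by
    intro x
    have : ∀ ω, X (ξ ω, realizedHistory A R t ω) = {ω | A t ω = a}.indicator 1 ω := fun ω => by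
      simp [X, ← h.action_eq, Set.indicator]
    simp only [this]
    rw [setIntegral_indicator hS]
    simp
  let L : Ω → ℝ := fun ω =>
    armLik a (1 / 2) (realizedHistory A R t ω) / armLik a (1 / 2 - Δ) (realizedHistory A R t ω)
  have hp : (0 : ℝ) < (1 / 4) ^ t := by positivity
  have hLi : Integrable L P := by
    refine Integrable.of_bound (C := 1 / (1 / 4) ^ t) (Measurable.aestronglyMeasurable ?_)
      (.of_forall fun ω => ?_)
    · exact ((measurable_armLik _ _ t).comp (h.measurable_history t)).div
        ((measurable_armLik _ _ t).comp (h.measurable_history t))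
    · rw [Real.norm_eq_abs, abs_div, abs_of_nonneg (armLik_nonneg a hhalf _),
        abs_of_pos (hp.trans_le (pow_le_armLik a hy _))]
      exact div_le_div₀ zero_le_one (armLik_le_one a hhalf _) hp (pow_le_armLik a hy _)
  have hXi : Integrable (fun ω => X (ξ ω, realizedHistory A R t ω)) P :=
    Integrable.of_bound (hX.comp (h.measurable_seed.prodMk
      (h.measurable_history t))).aestronglyMeasurable 1 (.of_forall fun _ => hX1 _)
  have hLX : Integrable (fun ω => L ω * X (ξ ω, realizedHistory A R t ω)) P :=
    hLi.mul_bdd hXi.aestronglyMeasurable (.of_forall fun _ => hX1 _)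
  have e1 := h.setIntegral_eq_armLik_ratio h01 a hhalf hy t hX hX1
  -- The constant test function shows that the term `2 (L - 1)` contributes nothing once weighted by
  -- the prior of the middle mean.
  have e2 := h.setIntegral_eq_armLik_ratio h01 a hhalf hy t (φ := fun _ => 1) measurable_const
    (C := 1) (fun _ => by simp)
  obtain ⟨hWi, hW⟩ := h.setIntegral_linearLogLik a Δ t
  have hle : ∫ ω in {ω | θ a ω = 1 / 2 - Δ}, 3 / 4 * (L ω * X (ξ ω, realizedHistory A R t ω)) ∂P ≤
      ∫ ω in {ω | θ a ω = 1 / 2 - Δ}, (5 / 4 * X (ξ ω, realizedHistory A R t ω) +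
        2 * (L ω - 1) + 2 * linearLogLik a Δ (realizedHistory A R t ω)) ∂P := by
    refine setIntegral_mono (hLX.const_mul _).integrableOn
      (((hXi.const_mul _).add ((hLi.sub (integrable_const 1)).const_mul _)).add
        (hWi.const_mul _)).integrableOn fun ω => ?_
    refine mul_indicator_le_of_exp_neg_le ?_ (exp_neg_linearLogLik_le a hΔ fun s => ?_)
    · simp only [X]; split_ifs <;> simp
    · exact h.reward_mem s ω
  have i1 : IntegrableOn (fun ω => 5 / 4 * X (ξ ω, realizedHistory A R t ω))
      {ω | θ a ω = 1 / 2 - Δ} P := (hXi.const_mul _).integrableOn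
  have i2 : IntegrableOn (fun ω => 2 * (L ω - 1)) {ω | θ a ω = 1 / 2 - Δ} P :=
    ((hLi.sub (integrable_const 1)).const_mul _).integrableOn
  have i12 : IntegrableOn (fun ω => 5 / 4 * X (ξ ω, realizedHistory A R t ω) + 2 * (L ω - 1))
      {ω | θ a ω = 1 / 2 - Δ} P := i1.add i2
  rw [integral_add i12 (hWi.const_mul _).integrableOn, integral_add i1 i2,
    integral_const_mul, integral_const_mul, integral_const_mul, integral_const_mul,
    integral_sub hLi.integrableOn (integrable_const 1), hW, hXint] at hle
  rw [hXint] at e1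
  simp only [integral_const, measureReal_restrict_apply_univ, smul_eq_mul, mul_one] at hle e2
  have := mul_le_mul_of_nonneg_left hle (measureReal_nonneg (μ := P) (s := {ω | θ a ω = 1 / 2}))
  simp only [L] at this
  linear_combination this + 3 / 4 * e1 - 2 * e2

/-- Up to its first play an arm has produced no rewards, so the choice to play it cannot depend on
its mean. -/
theorem measureReal_first_play (h01 : ∀ᵐ ω ∂P, ∀ a, θ a ω ∈ Set.Icc (0 : ℝ) 1) (a : ℕ)
    {x y : ℝ} (hx : x ∈ Set.Icc (0 : ℝ) 1) (hy : y ∈ Set.Icc (1 / 4 : ℝ) (3 / 4)) (t : ℕ) :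
    P.real {ω | θ a ω = y} *
        P.real ({ω | θ a ω = x} ∩ {ω | A t ω = a ∧ ∀ s : Fin t, A s ω ≠ a}) =
      P.real {ω | θ a ω = x} *
        P.real ({ω | θ a ω = y} ∩ {ω | A t ω = a ∧ ∀ s : Fin t, A s ω ≠ a}) := by
  let S : Set (Ξ × History t) := {z | ψ.act t z.2 z.1 = a ∧ ∀ s : Fin t, (z.2 s).1 ≠ a}
  have hS : MeasurableSet S := by
    refine MeasurableSet.inter (((ψ.measurable_act t).comp
      (measurable_snd.prodMk measurable_fst)) (measurableSet_singleton a)) ?_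
    refine MeasurableSet.congr (s := ⋂ s : Fin t, {z : Ξ × History t | (z.2 s).1 ≠ a})
      (MeasurableSet.iInter fun s => ?_) ?_
    · exact (measurable_fst.comp ((measurable_pi_apply s).comp measurable_snd))
        (measurableSet_singleton a).compl
    · ext z
      exact Set.mem_iInter
  have hSΩ : MeasurableSet {ω | A t ω = a ∧ ∀ s : Fin t, A s ω ≠ a} := by
    have := (h.measurable_seed.prodMk (h.measurable_history t)) hS
    simpa [S, Set.preimage, realizedHistory, h.action_eq t] using this
  have hind : ∀ ω, S.indicator (1 : Ξ × History t → ℝ) (ξ ω, realizedHistory A R t ω) =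
      {ω | A t ω = a ∧ ∀ s : Fin t, A s ω ≠ a}.indicator 1 ω := fun ω => by
    have hiff : (ξ ω, realizedHistory A R t ω) ∈ S ↔
        ω ∈ {ω | A t ω = a ∧ ∀ s : Fin t, A s ω ≠ a} := by
      simp [S, h.action_eq t ω, realizedHistory]
    by_cases hω : ω ∈ {ω | A t ω = a ∧ ∀ s : Fin t, A s ω ≠ a}
    · rw [Set.indicator_of_mem hω, Set.indicator_of_mem (hiff.2 hω)]; rfl
    · rw [Set.indicator_of_notMem hω, Set.indicator_of_notMem (mt hiff.1 hω)]
  have key := h.setIntegral_eq_armLik_ratio h01 a hx hy t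
    (φ := S.indicator 1) (measurable_one.indicator hS) (C := 1) (fun z => by
      by_cases hz : z ∈ S <;> simp [hz])
  have hint : ∀ x, ∫ ω in {ω | θ a ω = x},
      {ω | A t ω = a ∧ ∀ s : Fin t, A s ω ≠ a}.indicator (1 : Ω → ℝ) ω ∂P =
      P.real ({ω | θ a ω = x} ∩ {ω | A t ω = a ∧ ∀ s : Fin t, A s ω ≠ a}) := by
    intro x
    rw [setIntegral_indicator hSΩ]
    simp
  have hone : ∀ ω,
      armLik a x (realizedHistory A R t ω) / armLik a y (realizedHistory A R t ω) *
        {ω | A t ω = a ∧ ∀ s : Fin t, A s ω ≠ a}.indicator (1 : Ω → ℝ) ω =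
        {ω | A t ω = a ∧ ∀ s : Fin t, A s ω ≠ a}.indicator (1 : Ω → ℝ) ω := by
    intro ω
    by_cases hω : ω ∈ {ω | A t ω = a ∧ ∀ s : Fin t, A s ω ≠ a}
    · have : ∀ x, armLik a x (realizedHistory A R t ω) = 1 := fun x =>
        Finset.prod_eq_one fun s _ => if_neg (hω.2 s)
      simp [this]
    · simp [hω]
  simp only [hind, hone, hint] at key
  exact key

end IsBernoulliBanditRun

/-! ### Discounted sums and the numerical bound -/

theorem tsum_geometric_mul_partialSum {α : ℝ} (h0 : 0 ≤ α) (h1 : α < 1) {U : ℕ → ℝ}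
    (hU0 : ∀ t, 0 ≤ U t) (hU1 : ∀ t, U t ≤ 1) :
    Summable (fun t => α ^ t * ∑ s ∈ Finset.range t, U s) ∧
      (1 - α) * ∑' t, α ^ t * ∑ s ∈ Finset.range t, U s = α * ∑' t, α ^ t * U t := by
  have hsU : Summable (fun t => α ^ t * U t) :=
    (summable_geometric_of_lt_one h0 h1).of_nonneg_of_le
      (fun t => mul_nonneg (pow_nonneg h0 t) (hU0 t))
      (fun t => mul_le_of_le_one_right (pow_nonneg h0 t) (hU1 t))
  have hs : Summable (fun t => α ^ t * ∑ s ∈ Finset.range t, U s) := by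
    refine (hasSum_coe_mul_geometric_of_norm_lt_one
      (by rwa [Real.norm_eq_abs, abs_of_nonneg h0] : ‖α‖ < 1)).summable.of_nonneg_of_le
      (fun t => mul_nonneg (pow_nonneg h0 t) (Finset.sum_nonneg fun s _ => hU0 s)) fun t => ?_
    rw [mul_comm]
    refine mul_le_mul_of_nonneg_right ?_ (pow_nonneg h0 t)
    simpa using Finset.sum_le_sum fun s (_ : s ∈ Finset.range t) => hU1 s
  refine ⟨hs, ?_⟩
  have e := hs.tsum_eq_zero_add
  have e2 : ∀ t, α ^ (t + 1) * ∑ s ∈ Finset.range (t + 1), U s =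
      α * (α ^ t * ∑ s ∈ Finset.range t, U s) + α * (α ^ t * U t) := fun t => by
    rw [Finset.sum_range_succ]; ring
  simp only [e2, Finset.range_zero, Finset.sum_empty, mul_zero, zero_add] at e
  rw [(hs.mul_left α).tsum_add (hsU.mul_left α), tsum_mul_left, tsum_mul_left] at e
  linarith

theorem tsum_geometric_mul_succ {α : ℝ} (h0 : 0 ≤ α) (h1 : α < 1) :
    HasSum (fun t : ℕ => α ^ t * ((t : ℝ) + 1)) (1 / (1 - α) ^ 2) := by
  have h2 := (hasSum_coe_mul_geometric_of_norm_lt_one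
    (by rwa [Real.norm_eq_abs, abs_of_nonneg h0] : ‖α‖ < 1)).add (hasSum_geometric_of_lt_one h0 h1)
  have hb : 1 - α ≠ 0 := by linarith
  have e : 1 / (1 - α) ^ 2 = α / (1 - α) ^ 2 + (1 - α)⁻¹ := by
    field_simp
    ring
  rw [e]
  have ef : (fun t : ℕ => α ^ t * ((t : ℝ) + 1)) = fun t : ℕ => (t : ℝ) * α ^ t + α ^ t :=
    funext fun t => by ring
  rw [ef]
  exact h2

/-- With discounted totals `u`, `v`, `τ`, the argument is `v ≤ 7/3 u` and `τ ≤ 1/18`, so `u + v + τ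
= 1 / (1 - α)` forces `u` to be large. -/
theorem le_tsum_discounted_regret {α δ D Δ ε : ℝ} (hα : α ∈ Set.Ioo (0 : ℝ) 1)
    (hδ : δ ∈ Set.Ioo (0 : ℝ) (1 / 2)) (hD : D ∈ Set.Ioo (0 : ℝ) (1 / 4))
    (hΔ : 0 < Δ) (hΔ4 : Δ ≤ 1 / 4) (hΔsq : Δ ^ 2 * (32 * δ) ≤ 1 - α) (hε0 : 0 < ε)
    (hε1 : ε ≤ 1 / 36 * (1 - α) ^ 2) (hε2 : ε ≤ 4 / 9 * Δ ^ 2 * (1 - α) ^ 2)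
    {U V T : ℕ → ℝ} (hU : ∀ t, 0 ≤ U t) (hV : ∀ t, 0 ≤ V t) (hT : ∀ t, 0 ≤ T t)
    (hsum : ∀ t, U t + V t + T t = 1)
    (hVU : ∀ t, (1 - δ) * (3 / 4 * V t) ≤
      (δ - ε) * (5 / 4 * U t + 8 * Δ ^ 2 * ∑ s ∈ Finset.range t, U s))
    (hTε : ∀ t, (1 - δ) * T t ≤ ε * (t + 1)) :
    Δ / (1 - α) / 8 ≤ ∑' t, α ^ t * (Δ * U t - D * T t) := by
  obtain ⟨h0, h1⟩ := hα
  have hb : 0 < 1 - α := by linarith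
  have hp : ∀ t, 0 ≤ α ^ t := fun t => pow_nonneg h0.le t
  have hsg := summable_geometric_of_lt_one h0.le h1
  have hsm : ∀ {X : ℕ → ℝ}, (∀ t, 0 ≤ X t) → (∀ t, X t ≤ 1) → Summable (fun t => α ^ t * X t) :=
    fun hX0 hX1 => hsg.of_nonneg_of_le (fun t => mul_nonneg (hp t) (hX0 t))
      (fun t => mul_le_of_le_one_right (hp t) (hX1 t))
  have hU1 : ∀ t, U t ≤ 1 := fun t => by linarith [hsum t, hV t, hT t]
  have hsU := hsm hU hU1
  have hsV := hsm hV fun t => by linarith [hsum t, hU t, hT t]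
  have hsT := hsm hT fun t => by linarith [hsum t, hU t, hV t]
  obtain ⟨hsS, hS⟩ := tsum_geometric_mul_partialSum h0.le h1 hU hU1
  have htot : (∑' t, α ^ t * U t) + (∑' t, α ^ t * V t) + (∑' t, α ^ t * T t) = 1 / (1 - α) := by
    rw [← hsU.tsum_add hsV, ← (hsU.add hsV).tsum_add hsT, one_div,
      ← tsum_geometric_of_lt_one h0.le h1]
    refine tsum_congr fun t => ?_
    rw [← mul_add, ← mul_add, hsum, mul_one]
  have hreg : ∑' t, α ^ t * (Δ * U t - D * T t) =
      Δ * (∑' t, α ^ t * U t) - D * ∑' t, α ^ t * T t := by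
    rw [← tsum_mul_left, ← tsum_mul_left, ← (hsU.mul_left Δ).tsum_sub (hsT.mul_left D)]
    exact tsum_congr fun t => by ring
  have hVle : (1 - δ) * (3 / 4 * ∑' t, α ^ t * V t) ≤ (δ - ε) * (5 / 4 * (∑' t, α ^ t * U t) +
      8 * Δ ^ 2 * ∑' t, α ^ t * ∑ s ∈ Finset.range t, U s) := by
    have hl := (hsV.mul_left (3 / 4)).mul_left (1 - δ)
    have hr := ((hsU.mul_left (5 / 4)).add (hsS.mul_left (8 * Δ ^ 2))).mul_left (δ - ε)
    have := hl.tsum_le_tsum (fun t => ?_) hr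
    · rwa [tsum_mul_left, tsum_mul_left, tsum_mul_left,
        (hsU.mul_left (5 / 4)).tsum_add (hsS.mul_left (8 * Δ ^ 2)), tsum_mul_left,
        tsum_mul_left] at this
    · have := mul_le_mul_of_nonneg_left (hVU t) (hp t)
      linear_combination this
  have hTle : (1 - δ) * ∑' t, α ^ t * T t ≤ ε * (1 / (1 - α) ^ 2) := by
    have hss := tsum_geometric_mul_succ h0.le h1
    rw [← hss.tsum_eq, ← tsum_mul_left, ← tsum_mul_left]
    refine (hsT.mul_left _).tsum_le_tsum (fun t => ?_) (hss.summable.mul_left _)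
    have := mul_le_mul_of_nonneg_left (hTε t) (hp t)
    linear_combination this
  have hu : 0 ≤ ∑' t, α ^ t * U t := tsum_nonneg fun t => mul_nonneg (hp t) (hU t)
  have hv : 0 ≤ ∑' t, α ^ t * V t := tsum_nonneg fun t => mul_nonneg (hp t) (hV t)
  have hτ : 0 ≤ ∑' t, α ^ t * T t := tsum_nonneg fun t => mul_nonneg (hp t) (hT t)
  rw [hreg]
  generalize (∑' t, α ^ t * U t) = u at *
  generalize (∑' t, α ^ t * V t) = v at *
  generalize (∑' t, α ^ t * T t) = τ at *
  generalize (∑' t, α ^ t * ∑ s ∈ Finset.range t, U s) = σ at *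
  have hσ : 0 ≤ σ := by
    by_contra hneg
    have := mul_neg_of_pos_of_neg hb (not_le.1 hneg)
    linarith [mul_nonneg h0.le hu]
  have hN : 1 ≤ 1 / (1 - α) := by rw [le_div_iff₀ hb]; linarith
  -- Here `(1 - α) σ = α u ≤ u`.
  have hΔσ : 32 * δ * (Δ ^ 2 * σ) ≤ u := by
    have := mul_le_mul_of_nonneg_right hΔsq hσ
    nlinarith
  have hvu : v ≤ 7 / 3 * u := by
    have h5 : (δ - ε) * (5 / 4 * u + 8 * Δ ^ 2 * σ) ≤ δ * (5 / 4 * u + 8 * Δ ^ 2 * σ) :=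
      mul_le_mul_of_nonneg_right (by linarith) (by positivity)
    have h6 : (1 - δ) * (3 / 4 * v) ≤ (5 / 4 * δ + 1 / 4) * u := by nlinarith
    -- The constant `7/4` makes the two sides agree at `δ = 1/2`.
    have h7 : (5 / 4 * δ + 1 / 4) * u ≤ (7 / 4 * (1 - δ)) * u :=
      mul_le_mul_of_nonneg_right (by linarith [hδ.2]) hu
    have h8 : (1 - δ) * (3 / 4 * v) ≤ (1 - δ) * (7 / 4 * u) := by linarith
    have := le_of_mul_le_mul_left h8 (by linarith [hδ.2])
    linarith
  have hb2 : 0 < (1 - α) ^ 2 := by positivity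
  have hτ2 : τ ≤ 2 * (ε * (1 / (1 - α) ^ 2)) := by nlinarith [hδ.2]
  have hε1' : ε * (1 / (1 - α) ^ 2) ≤ 1 / 36 := by
    rw [mul_one_div, div_le_iff₀ hb2]; exact hε1
  have hε2' : ε * (1 / (1 - α) ^ 2) ≤ 4 / 9 * Δ ^ 2 := by
    rw [mul_one_div, div_le_iff₀ hb2]; exact hε2
  -- The two bounds on `ε / (1 - α)²` have geometric mean `Δ / 9`, so `τ ≤ 2Δ / 9`, and `D < 1/4`.
  have hDτ : D * τ ≤ Δ / 18 := by
    have : D * τ ≤ 1 / 4 * τ := mul_le_mul_of_nonneg_right hD.2.le hτ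
    nlinarith
  have hΔu : Δ * (3 / 10 * (1 / (1 - α) - 1 / 18)) ≤ Δ * u :=
    mul_le_mul_of_nonneg_left (by linarith) hΔ.le
  have hΔN : Δ ≤ Δ * (1 / (1 - α)) := le_mul_of_one_le_right hΔ.le hN
  have hrw : Δ / (1 - α) = Δ * (1 / (1 - α)) := by rw [mul_one_div]
  rw [hrw]
  linarith

/-! ### Summation over the arms -/

theorem hasSum_measureReal_iUnion {Ω : Type*} {mΩ : MeasurableSpace Ω} {P : Measure Ω}
    [IsProbabilityMeasure P] {E : ℕ → Set Ω} (hE : ∀ a, MeasurableSet (E a))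
    (hd : Pairwise (Function.onFun Disjoint E)) :
    HasSum (fun a => P.real (E a)) (P.real (⋃ a, E a)) := by
  have hu := measure_iUnion (μ := P) hd hE
  have := ENNReal.hasSum_toReal (f := fun a => P (E a)) (by rw [← hu]; exact measure_ne_top P _)
  rw [← ENNReal.tsum_toReal_eq (fun a => measure_ne_top P _), ← hu] at this
  exact this

theorem measureReal_eq_add_three {Ω : Type*} {mΩ : MeasurableSpace Ω} {P : Measure Ω}
    [IsProbabilityMeasure P] {X : Ω → ℝ} (hX : Measurable X) {x y z : ℝ} (hxy : x ≠ y)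
    (hxz : x ≠ z) (hyz : y ≠ z) :
    P.real {ω | X ω = x ∨ X ω = y ∨ X ω = z} =
      P.real {ω | X ω = x} + P.real {ω | X ω = y} + P.real {ω | X ω = z} := by
  have hm : ∀ c, MeasurableSet {ω | X ω = c} := fun c => hX (measurableSet_singleton c)
  have e : {ω | X ω = x ∨ X ω = y ∨ X ω = z} =
      ({ω | X ω = x} ∪ {ω | X ω = y}) ∪ {ω | X ω = z} := by
    ext ω; simp [or_assoc]
  rw [e, measureReal_union _ (hm z), measureReal_union _ (hm y)]
  · exact Set.disjoint_left.2 fun ω h1 h2 => hxy (h1.symm.trans h2)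
  · refine Set.disjoint_left.2 fun ω h1 h2 => ?_
    rcases h1 with h1 | h1
    · exact hxz (h1.symm.trans h2)
    · exact hyz (h1.symm.trans h2)

namespace IsBernoulliBanditRun

variable {Ω Ξ : Type*} {mΩ : MeasurableSpace Ω} [MeasurableSpace Ξ] {P : Measure Ω}
  [IsProbabilityMeasure P] {ψ : AdaptivePolicy Ξ} {θ : ℕ → Ω → ℝ} {ξ : Ω → Ξ}
  {A : ℕ → Ω → ℕ} {R : ℕ → Ω → ℝ} (h : IsBernoulliBanditRun P ψ θ ξ A R)
include h

theorem hasSum_measureReal_play (x : ℝ) (t : ℕ) :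
    HasSum (fun a => P.real ({ω | θ a ω = x} ∩ {ω | A t ω = a}))
      (P.real {ω | θ (A t ω) ω = x}) := by
  have hu : {ω | θ (A t ω) ω = x} = ⋃ a, ({ω | θ a ω = x} ∩ {ω | A t ω = a}) := by
    ext ω; simp
  rw [hu]
  refine hasSum_measureReal_iUnion (fun a => (h.measurableSet_mean_eq a x).inter
    (h.measurable_action t (measurableSet_singleton a))) fun a b hab => ?_
  exact Set.disjoint_left.2 fun ω h1 h2 => hab (h1.2.symm.trans h2.2)

theorem measureReal_good_le (h01 : ∀ᵐ ω ∂P, ∀ a, θ a ω ∈ Set.Icc (0 : ℝ) 1)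
    {Δ p q : ℝ} (hΔ : Δ ∈ Set.Icc (0 : ℝ) (1 / 4)) (hp : ∀ a, P.real {ω | θ a ω = 1 / 2 - Δ} = p)
    (hq : ∀ a, P.real {ω | θ a ω = 1 / 2} = q) (t : ℕ) :
    p * (3 / 4 * P.real {ω | θ (A t ω) ω = 1 / 2}) ≤
      q * (5 / 4 * P.real {ω | θ (A t ω) ω = 1 / 2 - Δ} +
        8 * Δ ^ 2 * ∑ s ∈ Finset.range t, P.real {ω | θ (A s ω) ω = 1 / 2 - Δ}) := by
  refine hasSum_le (fun a => ?_)
    (((h.hasSum_measureReal_play (1 / 2) t).mul_left (3 / 4)).mul_left p)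
    ((((h.hasSum_measureReal_play (1 / 2 - Δ) t).mul_left (5 / 4)).add
      ((hasSum_sum fun s (_ : s ∈ Finset.range t) =>
        h.hasSum_measureReal_play (1 / 2 - Δ) s).mul_left (8 * Δ ^ 2))).mul_left q)
  have := h.measureReal_play_good_le h01 a hΔ t
  rwa [hp, hq, Fin.sum_univ_eq_sum_range
    (fun s => P.real ({ω | θ a ω = 1 / 2 - Δ} ∩ {ω | A s ω = a}))] at this

/-- An arm played at `t` had its first play at some `s ≤ t`. For each of these `t + 1` periods,
exchanging `x` for `y` in the first-play event costs the ratio `q / p`, and the exchanged events are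
disjoint over arms. -/
theorem measureReal_top_le (h01 : ∀ᵐ ω ∂P, ∀ a, θ a ω ∈ Set.Icc (0 : ℝ) 1)
    {x y p q : ℝ} (hx : x ∈ Set.Icc (0 : ℝ) 1) (hy : y ∈ Set.Icc (1 / 4 : ℝ) (3 / 4))
    (hp : ∀ a, P.real {ω | θ a ω = y} = p)
    (hq : ∀ a, P.real {ω | θ a ω = x} = q) (t : ℕ) :
    p * P.real {ω | θ (A t ω) ω = x} ≤ q * (t + 1) := by
  let N : ℕ → ℕ → Set Ω := fun s a => {ω | A s ω = a ∧ ∀ r : Fin s, A r ω ≠ a}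
  have hN : ∀ s a, MeasurableSet (N s a) := fun s a => by
    refine MeasurableSet.inter (h.measurable_action s (measurableSet_singleton a)) ?_
    refine MeasurableSet.congr (s := ⋂ r : Fin s, {ω | A r ω ≠ a})
      (MeasurableSet.iInter fun r =>
        h.measurable_action r (measurableSet_singleton a).compl) ?_
    ext z
    exact Set.mem_iInter
  have hsum : ∀ z s, HasSum (fun a => P.real ({ω | θ a ω = z} ∩ N s a))
      (P.real (⋃ a, ({ω | θ a ω = z} ∩ N s a))) := fun z s => by
    refine hasSum_measureReal_iUnion (fun a => (h.measurableSet_mean_eq a z).inter (hN s a))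
      fun a b hab => ?_
    exact Set.disjoint_left.2 fun ω h1 h2 => hab (h1.2.1.symm.trans h2.2.1)
  have hp0 : 0 ≤ p := hp 0 ▸ measureReal_nonneg
  have hq0 : 0 ≤ q := hq 0 ▸ measureReal_nonneg
  have hfirst : ∀ s, p * P.real (⋃ a, ({ω | θ a ω = x} ∩ N s a)) ≤ q := by
    intro s
    have e : p * P.real (⋃ a, ({ω | θ a ω = x} ∩ N s a)) =
        q * P.real (⋃ a, ({ω | θ a ω = y} ∩ N s a)) := by
      refine ((hsum x s).mul_left p).unique ?_
      convert (hsum y s).mul_left q using 1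
      funext a
      have := h.measureReal_first_play h01 a hx hy s
      rwa [hp, hq] at this
    rw [e]
    exact mul_le_of_le_one_right hq0 measureReal_le_one
  have hsub : {ω | θ (A t ω) ω = x} ⊆
      ⋃ s ∈ Finset.range (t + 1), ⋃ a, ({ω | θ a ω = x} ∩ N s a) := by
    classical
    intro ω hω
    have hex : ∃ s, A s ω = A t ω := ⟨t, rfl⟩
    refine Set.mem_iUnion₂.2 ⟨Nat.find hex, ?_, Set.mem_iUnion.2 ⟨A t ω, hω,
      Nat.find_spec hex, fun r => Nat.find_min hex r.2⟩⟩
    exact Finset.mem_range.2 (Nat.lt_succ_of_le (Nat.find_min' hex rfl))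
  calc p * P.real {ω | θ (A t ω) ω = x}
      ≤ p * ∑ s ∈ Finset.range (t + 1), P.real (⋃ a, ({ω | θ a ω = x} ∩ N s a)) :=
        mul_le_mul_of_nonneg_left ((measureReal_mono hsub (measure_ne_top P _)).trans
          (measureReal_biUnion_finset_le _ _)) hp0
    _ ≤ ∑ _s ∈ Finset.range (t + 1), q := by
        rw [Finset.mul_sum]
        exact Finset.sum_le_sum fun s _ => hfirst s
    _ = q * (t + 1) := by simp [mul_comm]

/-- By independence, the first `n` arms all miss the value `x` with probability `(1 - q)^n`. -/
theorem ae_exists_mean_eq {x q : ℝ} (hq0 : 0 < q) (hq : ∀ a, P.real {ω | θ a ω = x} = q) :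
    ∀ᵐ ω ∂P, ∃ a, θ a ω = x := by
  have hc : ∀ a, P (θ a ⁻¹' {x}ᶜ) = ENNReal.ofReal (1 - q) := fun a => by
    have h1 : P.real (θ a ⁻¹' {x}ᶜ) = 1 - q := by
      have := probReal_compl_eq_one_sub (μ := P) (h.measurableSet_mean_eq a x)
      rw [hq] at this
      exact this
    rw [← h1, ofReal_measureReal]
  have hle : ∀ n : ℕ, P {ω | ¬ ∃ a, θ a ω = x} ≤ ENNReal.ofReal (1 - q) ^ n := fun n => by
    have hi := h.indep_means.measure_inter_preimage_eq_mul (Finset.range n)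
      (sets := fun _ => {x}ᶜ) fun _ _ => (measurableSet_singleton x).compl
    simp only [hc, Finset.prod_const, Finset.card_range] at hi
    rw [← hi]
    refine measure_mono fun ω hω => Set.mem_iInter₂.2 fun a _ => ?_
    exact fun ha => hω ⟨a, ha⟩
  have hlim := ENNReal.tendsto_pow_atTop_nhds_zero_of_lt_one
    (show ENNReal.ofReal (1 - q) < 1 by rw [ENNReal.ofReal_lt_one]; linarith)
  exact le_antisymm (ge_of_tendsto' hlim hle) zero_le

end IsBernoulliBanditRun

/-! ### The regret in terms of play probabilities -/

namespace IsBernoulliBanditRun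

variable {Ω Ξ : Type*} {mΩ : MeasurableSpace Ω} [MeasurableSpace Ξ] {P : Measure Ω}
  [IsProbabilityMeasure P] {ψ : AdaptivePolicy Ξ} {θ : ℕ → Ω → ℝ} {ξ : Ω → Ξ}
  {A : ℕ → Ω → ℕ} {R : ℕ → Ω → ℝ} (h : IsBernoulliBanditRun P ψ θ ξ A R)
include h

theorem integral_half_sub_reward {Δ D : ℝ} (hΔ : 0 < Δ) (hD : 0 < D)
    (h3 : ∀ᵐ ω ∂P, ∀ a, θ a ω = 1 / 2 - Δ ∨ θ a ω = 1 / 2 ∨ θ a ω = 1 / 2 + D) (t : ℕ) :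
    Integrable (R t) P ∧ ∫ ω, (1 / 2 - R t ω) ∂P =
      Δ * P.real {ω | θ (A t ω) ω = 1 / 2 - Δ} - D * P.real {ω | θ (A t ω) ω = 1 / 2 + D} := by
  have hRi : Integrable (R t) P :=
    Integrable.of_bound (h.measurable_reward t).aestronglyMeasurable 1 (.of_forall fun ω => by
      rw [Real.norm_eq_abs, abs_of_nonneg (h.reward_mem_Icc t ω).1]
      exact (h.reward_mem_Icc t ω).2)
  refine ⟨hRi, ?_⟩
  have hRθ := h.integral_reward_mul t (g := fun _ => 1) measurable_const (C := 1)
    (fun _ => by simp)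
  simp only [mul_one] at hRθ
  have hm : ∀ x, MeasurableSet {ω | θ (A t ω) ω = x} := fun x =>
    h.measurable_mean_action t (measurableSet_singleton x)
  have hi : ∀ x c : ℝ,
      Integrable ({ω | θ (A t ω) ω = x}.indicator fun _ => c) P := fun x c =>
    (integrable_const c).indicator (hm x)
  have hae : (fun ω => θ (A t ω) ω) =ᵐ[P] fun ω => 1 / 2 -
      ({ω | θ (A t ω) ω = 1 / 2 - Δ}.indicator (fun _ => Δ) ω -
        {ω | θ (A t ω) ω = 1 / 2 + D}.indicator (fun _ => D) ω) := by
    filter_upwards [h3] with ω hω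
    have e1 : (1 / 2 - Δ : ℝ) ≠ 1 / 2 + D := by linarith
    simp only [Set.indicator, Set.mem_ofPred_eq]
    rcases hω (A t ω) with h0 | h0 | h0
    · rw [if_pos h0, if_neg (fun h' => e1 (h0.symm.trans h')), h0]
      ring
    · rw [if_neg, if_neg, h0]
      · ring
      · exact fun h' => absurd (h0.symm.trans h') (by linarith)
      · exact fun h' => absurd (h0.symm.trans h') (by linarith)
    · rw [if_neg (fun h' => e1 (h'.symm.trans h0)), if_pos h0, h0]
      ring
  have hid : Integrable (fun ω => {ω | θ (A t ω) ω = 1 / 2 - Δ}.indicator (fun _ => Δ) ω -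
      {ω | θ (A t ω) ω = 1 / 2 + D}.indicator (fun _ => D) ω) P := (hi _ _).sub (hi _ _)
  rw [integral_sub (integrable_const _) hRi, hRθ, integral_congr_ae hae,
    integral_sub (integrable_const _) hid, integral_sub (hi _ _) (hi _ _),
    integral_indicator (hm _), integral_indicator (hm _)]
  simp
  ring

theorem satisficingRegret_eq {Δ D α : ℝ} (hα : α ∈ Set.Ioo (0 : ℝ) 1) (hΔ : 0 < Δ) (hD : 0 < D)
    (h3 : ∀ᵐ ω ∂P, ∀ a, θ a ω = 1 / 2 - Δ ∨ θ a ω = 1 / 2 ∨ θ a ω = 1 / 2 + D)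
    (htop : ∀ᵐ ω ∂P, ∃ a, θ a ω = 1 / 2 + D) :
    satisficingRegret P θ R α D = ∑' t, α ^ t *
      (Δ * P.real {ω | θ (A t ω) ω = 1 / 2 - Δ} -
        D * P.real {ω | θ (A t ω) ω = 1 / 2 + D}) := by
  have hsup : ∀ᵐ ω ∂P, (⨆ a, θ a ω) = 1 / 2 + D := by
    filter_upwards [h3, htop] with ω hω ⟨a, ha⟩
    have hle : ∀ b, θ b ω ≤ 1 / 2 + D := fun b => by
      rcases hω b with h0 | h0 | h0 <;> linarith
    refine le_antisymm (ciSup_le hle) ?_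
    rw [← ha]
    exact le_ciSup (f := fun b => θ b ω) ⟨1 / 2 + D, Set.forall_mem_range.2 hle⟩ a
  have hRi := fun t => (h.integral_half_sub_reward hΔ hD h3 t).1
  have hint : ∀ t, Integrable (fun ω => α ^ t * (1 / 2 - R t ω)) P := fun t =>
    ((integrable_const _).sub (hRi t)).const_mul _
  have hnorm : ∀ t, ∫ ω, ‖α ^ t * (1 / 2 - R t ω)‖ ∂P ≤ α ^ t := fun t => by
    have : ∀ ω, ‖α ^ t * (1 / 2 - R t ω)‖ ≤ α ^ t := fun ω => by
      rw [norm_mul, Real.norm_of_nonneg (pow_nonneg hα.1.le t)]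
      refine mul_le_of_le_one_right (pow_nonneg hα.1.le t) ?_
      rw [Real.norm_eq_abs, abs_le]
      have := h.reward_mem_Icc t ω
      exact ⟨by linarith [this.2], by linarith [this.1]⟩
    simpa using integral_mono (hint t).norm (integrable_const (α ^ t)) this
  have hsum : Summable fun t => ∫ ω, ‖α ^ t * (1 / 2 - R t ω)‖ ∂P :=
    (summable_geometric_of_lt_one hα.1.le hα.2).of_nonneg_of_le
      (fun t => integral_nonneg fun _ => norm_nonneg _) hnorm
  have hae : (fun ω => ∑' t : ℕ, α ^ t * ((⨆ a, θ a ω) - D - R t ω)) =ᵐ[P]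
      fun ω => ∑' t : ℕ, α ^ t * (1 / 2 - R t ω) := by
    filter_upwards [hsup] with ω hω
    simp only [hω, add_sub_cancel_right]
  rw [satisficingRegret, integral_congr_ae hae,
    ← integral_tsum_of_summable_integral_norm hint hsum]
  refine tsum_congr fun t => ?_
  rw [integral_const_mul, (h.integral_half_sub_reward hΔ hD h3 t).2]

end IsBernoulliBanditRun

/-! ### The choice of `Δ` and the conclusion -/

/-- Both follow from `Δ = 1/4 min {1, √((1 - α) / (2δ))}`: the target is a multiple of `Δ / (1 -
α)`, and squaring passes through the minimum. -/
theorem min_inv_sqrt_eq {α δ Δ : ℝ} (hα : α < 1) (hδ : 0 < δ)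
    (hΔ : Δ = min (1 / 4) (1 / (4 * Real.sqrt 2) * Real.sqrt ((1 - α) / δ))) :
    1 / 32 * min (1 / (1 - α)) (Real.sqrt (1 / (2 * δ) / (1 - α))) = Δ / (1 - α) / 8 ∧
      Δ ^ 2 = 1 / 16 * min 1 ((1 - α) / (2 * δ)) := by
  have hb : 0 < 1 - α := by linarith
  have e1 : 1 / (4 * Real.sqrt 2) * Real.sqrt ((1 - α) / δ) =
      1 / 4 * Real.sqrt ((1 - α) / (2 * δ)) := by
    rw [show (1 - α) / (2 * δ) = (1 - α) / δ / 2 by field_simp,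
      Real.sqrt_div (by positivity) 2]
    field_simp
  have e2 : Real.sqrt (1 / (2 * δ) / (1 - α)) =
      1 / (1 - α) * Real.sqrt ((1 - α) / (2 * δ)) := by
    rw [show 1 / (2 * δ) / (1 - α) = (1 / (1 - α)) ^ 2 * ((1 - α) / (2 * δ)) by field_simp,
      Real.sqrt_mul (by positivity), Real.sqrt_sq (by positivity)]
  have hΔ' : Δ = 1 / 4 * min 1 (Real.sqrt ((1 - α) / (2 * δ))) := by
    rw [hΔ, e1, mul_min_of_nonneg _ _ (by norm_num : (0 : ℝ) ≤ 1 / 4), mul_one]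
  constructor
  · have : min (1 / (1 - α)) (1 / (1 - α) * Real.sqrt ((1 - α) / (2 * δ))) =
        1 / (1 - α) * min 1 (Real.sqrt ((1 - α) / (2 * δ))) := by
      rw [mul_min_of_nonneg _ _ (by positivity : 0 ≤ 1 / (1 - α)), mul_one]
    rw [e2, this, hΔ']
    ring
  · have hq : 0 ≤ (1 - α) / (2 * δ) := by positivity
    have hs := Real.sq_sqrt hq
    rw [hΔ', mul_pow]
    congr 1
    · norm_num
    · rcases le_total 1 (Real.sqrt ((1 - α) / (2 * δ))) with hc | hc
      · rw [min_eq_left hc, min_eq_left (by nlinarith), one_pow]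
      · rw [min_eq_right hc, min_eq_right (by nlinarith [Real.sqrt_nonneg ((1 - α) / (2 * δ))]), hs]

theorem mainTheorem5 (α δ D Δ ε : ℝ)
    (hα : α ∈ Set.Ioo (0 : ℝ) 1) (hδ : δ ∈ Set.Ioo (0 : ℝ) (1 / 2))
    (hD : D ∈ Set.Ioo (0 : ℝ) (1 / 4))
    (hΔ : Δ = min (1 / 4) (1 / (4 * Real.sqrt 2) * Real.sqrt ((1 - α) / δ)))
    (hε_pos : 0 < ε)
    (hε : ε ≤ 1 / 36 * min ((1 - α) ^ 2) ((1 - α) ^ 3 / (2 * δ)))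
    {Ω Ξ : Type*} [MeasurableSpace Ω] [MeasurableSpace Ξ]
    (P : Measure Ω) [IsProbabilityMeasure P]
    (ψ : AdaptivePolicy Ξ) (θ : ℕ → Ω → ℝ) (ξ : Ω → Ξ) (A : ℕ → Ω → ℕ) (R : ℕ → Ω → ℝ)
    (hrun : IsBernoulliBanditRun P ψ θ ξ A R)
    (hprior_low : ∀ a, P.real {ω | θ a ω = 1 / 2 - Δ} = 1 - δ)
    (hprior_mid : ∀ a, P.real {ω | θ a ω = 1 / 2} = δ - ε)
    (hprior_top : ∀ a, P.real {ω | θ a ω = 1 / 2 + D} = ε) :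
    1 / 32 * min (1 / (1 - α)) (Real.sqrt (1 / (2 * δ) / (1 - α)))
      ≤ satisficingRegret P θ R α D := by
  obtain ⟨hrhs, hΔsq⟩ := min_inv_sqrt_eq hα.2 hδ.1 hΔ
  have hb : 0 < 1 - α := by linarith [hα.2]
  have hδ0 := hδ.1
  have hD0 := hD.1
  have hΔ4 : Δ ≤ 1 / 4 := hΔ ▸ min_le_left _ _
  have hΔ0 : 0 < Δ := by rw [hΔ]; positivity
  have h3 : ∀ᵐ ω ∂P, ∀ a, θ a ω = 1 / 2 - Δ ∨ θ a ω = 1 / 2 ∨ θ a ω = 1 / 2 + D := by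
    refine ae_all_iff.2 fun a => ?_
    have hadd := measureReal_eq_add_three (P := P) (hrun.measurable_mean a)
      (x := 1 / 2 - Δ) (y := 1 / 2) (z := 1 / 2 + D) (by linarith) (by linarith) (by linarith)
    rw [hprior_low, hprior_mid, hprior_top] at hadd
    have hm : MeasurableSet {ω | θ a ω = 1 / 2 - Δ ∨ θ a ω = 1 / 2 ∨ θ a ω = 1 / 2 + D} :=
      (hrun.measurableSet_mean_eq a _).union ((hrun.measurableSet_mean_eq a _).union
        (hrun.measurableSet_mean_eq a _))
    have hc := probReal_compl_eq_one_sub (μ := P) hm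
    rw [hadd] at hc
    exact (measureReal_eq_zero_iff (measure_ne_top P _)).1 (hc.trans (by ring))
  have h01 : ∀ᵐ ω ∂P, ∀ a, θ a ω ∈ Set.Icc (0 : ℝ) 1 := by
    filter_upwards [h3] with ω hω a
    rcases hω a with h0 | h0 | h0 <;> rw [h0] <;> constructor <;> linarith [hD.2]
  rw [hrhs, hrun.satisficingRegret_eq hα hΔ0 hD.1 h3
    (hrun.ae_exists_mean_eq hε_pos hprior_top)]
  refine le_tsum_discounted_regret hα hδ hD hΔ0 hΔ4 ?_ hε_pos
    (hε.trans (mul_le_mul_of_nonneg_left (min_le_left _ _) (by norm_num))) ?_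
    (fun t => measureReal_nonneg) (fun t => measureReal_nonneg (s := {ω | θ (A t ω) ω = 1 / 2}))
    (fun t => measureReal_nonneg) (fun t => ?_)
    (hrun.measureReal_good_le h01 ⟨hΔ0.le, hΔ4⟩ hprior_low hprior_mid)
    (hrun.measureReal_top_le h01 ⟨by linarith, by linarith [hD.2]⟩
      ⟨by linarith, by linarith⟩ hprior_low hprior_top)
  · have : Δ ^ 2 ≤ 1 / 16 * ((1 - α) / (2 * δ)) :=
      hΔsq ▸ mul_le_mul_of_nonneg_left (min_le_right _ _) (by norm_num)
    calc Δ ^ 2 * (32 * δ) ≤ 1 / 16 * ((1 - α) / (2 * δ)) * (32 * δ) :=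
          mul_le_mul_of_nonneg_right this (by positivity)
      _ = 1 - α := by field_simp; norm_num
  -- Factoring `(1 - α)²` out of the minimum leaves `min 1 ((1 - α) / (2δ)) = 16 Δ²`, hence the
  -- constant `16/36 = 4/9`.
  · refine hε.trans (le_of_eq ?_)
    have e : (1 - α) ^ 3 / (2 * δ) = (1 - α) ^ 2 * ((1 - α) / (2 * δ)) := by ring
    have e' : min ((1 - α) ^ 2) ((1 - α) ^ 2 * ((1 - α) / (2 * δ))) =
        (1 - α) ^ 2 * min 1 ((1 - α) / (2 * δ)) := by
      rw [mul_min_of_nonneg _ _ (sq_nonneg (1 - α)), mul_one]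
    rw [e, e', hΔsq]
    ring
  · have hone : P.real {ω | θ (A t ω) ω = 1 / 2 - Δ ∨ θ (A t ω) ω = 1 / 2 ∨
        θ (A t ω) ω = 1 / 2 + D} = P.real Set.univ := by
      refine measureReal_congr ?_
      filter_upwards [h3] with ω hω
      exact propext ⟨fun _ => trivial, fun _ => hω (A t ω)⟩
    rwa [measureReal_eq_add_three (hrun.measurable_mean_action t) (by linarith) (by linarith)
      (by linarith), probReal_univ] at hone
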